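/- Let $\rho\in(0,\pi]$ and $h>0$. For $x\in\mathbb R^d$ and a unit vector $\xi\in\mathbb R^d$ let $C_{\rho,\xi,h}(x)=\{z\in\mathbb R^d:\ 0<\|z-x\|<h,\ \langle \xi,\tfrac{z-x}{\|z-x\|}\rangle>\cos(\rho/2)\}$ be the finite open cone with vertex $x$, axis $\xi$, opening angle $\rho$ and radius $h$. A set $S\subset\mathbb R^d$ is $\rho,h$-cone-convex if for every $x\in\partial S$ there is a unit vector $\xi$ with $C_{\rho,\xi,h}(x)\subset S^c$; let $\mathcal C_{\rho,h}$ be the class of nonempty compact $\rho,h$-cone-convex sets. For bounded $A\subset\mathbb R^d$, the $\rho,h$-cone-convex hull $\mathbb C_{\rho,h}(A)$ is the intersection of all $B\in\mathcal C_{\rho,h}$ with $A\subset B$, and the $\rho,h$-cone-convex hull by complement $\tilde{\mathbb C}_{\rho,h}(A)$ is the intersection of the complements of all the cones $C_{\rho,\xi,h}(y)$ (over all $y\in\mathbb R^d$ and unit vectors $\xi$) that do not meet $A$. Let $\tilde{\mathcal C}_{\rho,h}$ be the class of nonempty compact sets $S$ with $S=\tilde{\mathbb C}_{\rho,h}(S)$.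 Let $d_H$ denote the Hausdorff distance and, for a Borel measure $\nu$, let $d_\nu(A,C)=\nu(A\setminus C)+\nu(C\setminus A)$. **Theorem 4.** Let $P$ be a probability measure on $\mathbb R^d$, absolutely continuous with respect to Lebesgue measure, with compact support $S$. Let $X_1,X_2,\ldots$ be i.i.d. random vectors with distribution $P$, and let $\aleph_n=\{X_1,\ldots,X_n\}$. (a) If $S$ is $\rho,h$-cone-convex, then, as $n\to\infty$, $d_H(\mathbb C_{\rho,h}(\aleph_n),S)\to0$ almost surely, and, for every Borel measure $\nu$ on $\mathbb R^d$ that is finite on compact sets and whose restriction to $S$ is absolutely continuous with respect to $P$, $d_\nu(\mathbb C_{\rho,h}(\aleph_n),S)\to0$ almost surely. (b) If $S\in\tilde{\mathcal C}_{\rho,h}$, then, as $n\to\infty$, $d_H(\tilde{\mathbb C}_{\rho,h}(\aleph_n),S)\to0$ almost surely, and, for every $\nu$ as in (a), $d_\nu(\tilde{\mathbb C}_{\rho,h}(\aleph_n),S)\to0$ almost surely. -/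

import Mathlib

open MeasureTheory ProbabilityTheory Filter Topology

namespace ConeConvexity

variable {d : ℕ}

/-- The infinite open cone with vertex `x`, axis direction `ξ` (a unit vector) and opening
angle `ρ`. -/
def infiniteCone (ρ : ℝ) (ξ x : EuclideanSpace ℝ (Fin d)) : Set (EuclideanSpace ℝ (Fin d)) :=
  {z | z ≠ x ∧ Real.cos (ρ / 2) < inner ℝ ξ (‖z - x‖⁻¹ • (z - x))}

/-- The finite open cone: the infinite cone intersected with the open ball of radius `h`
centered at the vertex. -/
def finiteCone (ρ h : ℝ) (ξ x : EuclideanSpace ℝ (Fin d)) : Set (EuclideanSpace ℝ (Fin d)) :=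
  infiniteCone ρ ξ x ∩ Metric.ball x h

/-- `S` is `ρ,h`-cone-convex: every boundary point is the vertex of a finite open cone lying in
the complement of `S`. -/
def IsConeConvex (ρ h : ℝ) (S : Set (EuclideanSpace ℝ (Fin d))) : Prop :=
  ∀ x ∈ frontier S, ∃ ξ : EuclideanSpace ℝ (Fin d), ‖ξ‖ = 1 ∧ finiteCone ρ h ξ x ⊆ Sᶜ

/-- The class of nonempty compact `ρ,h`-cone-convex sets. -/
def coneConvexClass (d : ℕ) (ρ h : ℝ) : Set (Set (EuclideanSpace ℝ (Fin d))) :=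
  {S | S.Nonempty ∧ IsCompact S ∧ IsConeConvex ρ h S}

/-- The `ρ,h`-cone-convex hull: the intersection of all nonempty compact `ρ,h`-cone-convex sets
containing `S`. -/
def ccHull (ρ h : ℝ) (S : Set (EuclideanSpace ℝ (Fin d))) : Set (EuclideanSpace ℝ (Fin d)) :=
  ⋂₀ {B | B ∈ coneConvexClass d ρ h ∧ S ⊆ B}

/-- The `ρ,h`-cone-convex hull by complement: the intersection of the complements of all the
finite open cones of opening angle `ρ` and radius `h` that do not meet `S`. -/
def cccHull (ρ h : ℝ) (S : Set (EuclideanSpace ℝ (Fin d))) : Set (EuclideanSpace ℝ (Fin d)) :=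
  ⋂₀ {B | ∃ ξ y : EuclideanSpace ℝ (Fin d),
    ‖ξ‖ = 1 ∧ finiteCone ρ h ξ y ∩ S = ∅ ∧ B = (finiteCone ρ h ξ y)ᶜ}

/-- The class of nonempty compact sets that are `ρ,h`-cone-convex by complement, that is, equal
to the intersection of the complements of the finite cones disjoint from them. -/
def coneConvexByComplClass (d : ℕ) (ρ h : ℝ) : Set (Set (EuclideanSpace ℝ (Fin d))) :=
  {S | S.Nonempty ∧ IsCompact S ∧ S = cccHull ρ h S}

/-- The pseudometric `d_ν(A, C) = ν(A \ C) + ν(C \ A)`. -/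
noncomputable def distMeasure (ν : Measure (EuclideanSpace ℝ (Fin d)))
    (A C : Set (EuclideanSpace ℝ (Fin d))) : ENNReal :=
  ν (A \ C) + ν (C \ A)

/-- The set formed by the first `n` observations of the sequence `x`. -/
def sampleSet (x : ℕ → EuclideanSpace ℝ (Fin d)) (n : ℕ) : Set (EuclideanSpace ℝ (Fin d)) :=
  x '' Set.Iio n

end ConeConvexity

/-! Almost surely the sample lies in the support `S` and is dense in it, and every hull lies between
the sample and `S`. Hausdorff convergence then follows from compactness of `S` alone. For `d_ν` the
hulls increase, so it suffices that the points of `S` outside all of them form a null set. Such a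
point is approached by cones missing larger and larger samples. By compactness of axes and vertices
these accumulate at a cone missing the whole sample, hence missing `S`, with the point in its
closure (`exists_cone_disjoint_range`). Since `ρ ≤ π` the cone is convex, so the point is not a
Lebesgue density point of `S`; such points are null (`measure_eq_zero_of_mem_closure_convex`). Both
hulls fit this scheme through `hull_consistency`. -/

namespace ConeConvexity

open Metric Set

/-! ### Geometry and limits of finite cones -/

section Cones

variable {d : ℕ} {ρ h : ℝ} {ξ y z x : EuclideanSpace ℝ (Fin d)}

theorem mem_finiteCone_iff :
    z ∈ finiteCone ρ h ξ y ↔ ‖z - y‖ < h ∧ Real.cos (ρ / 2) * ‖z - y‖ < inner ℝ ξ (z - y) := by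
  rw [finiteCone, mem_inter_iff, mem_ball_iff_norm, and_comm]
  refine and_congr_right fun _ => ?_
  rcases eq_or_ne z y with rfl | hne
  · simp [infiniteCone]
  · have hpos : 0 < ‖z - y‖ := norm_pos_iff.2 (sub_ne_zero.2 hne)
    simp only [infiniteCone, mem_ofPred_eq, ne_eq, hne, not_false_eq_true, true_and,
      inner_smul_right]
    rw [inv_mul_eq_div, lt_div_iff₀ hpos]

/-- The closed counterpart of `finiteCone`, with its vertex. -/
def closedCone (ρ h : ℝ) (ξ y : EuclideanSpace ℝ (Fin d)) : Set (EuclideanSpace ℝ (Fin d)) :=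
  {z | ‖z - y‖ ≤ h ∧ Real.cos (ρ / 2) * ‖z - y‖ ≤ inner ℝ ξ (z - y)}

theorem finiteCone_subset_closedCone : finiteCone ρ h ξ y ⊆ closedCone ρ h ξ y := fun _ hz =>
  ⟨(mem_finiteCone_iff.1 hz).1.le, (mem_finiteCone_iff.1 hz).2.le⟩

theorem vertex_mem_closedCone (hh : 0 < h) : y ∈ closedCone ρ h ξ y := by
  simp [closedCone, hh.le]

theorem isOpen_finiteCone : IsOpen (finiteCone ρ h ξ y) := by
  have : finiteCone ρ h ξ y =
      {z | ‖z - y‖ < h} ∩ {z | Real.cos (ρ / 2) * ‖z - y‖ < inner ℝ ξ (z - y)} :=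
    Set.ext fun _ => mem_finiteCone_iff
  rw [this]
  exact (isOpen_lt (by fun_prop) (by fun_prop)).inter (isOpen_lt (by fun_prop) (by fun_prop))

/-- For `c ≥ 0` the map `v ↦ ⟪ξ, v⟫ - c * ‖v‖` is concave. Strictness at one end only is enough,
which serves both convexity of the cone and density of the open cone in the closed one. -/
theorem segment_subset_finiteCone_aux {c : ℝ} (hc : 0 ≤ c) {v w : EuclideanSpace ℝ (Fin d)}
    {a b : ℝ} (ha : 0 ≤ a) (hb : 0 < b) (hab : a + b = 1)
    (hv : ‖v‖ ≤ h) (hv' : c * ‖v‖ ≤ inner ℝ ξ v) (hw : ‖w‖ < h) (hw' : c * ‖w‖ < inner ℝ ξ w) :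
    ‖a • v + b • w‖ < h ∧ c * ‖a • v + b • w‖ < inner ℝ ξ (a • v + b • w) := by
  have hn : ‖a • v + b • w‖ ≤ a * ‖v‖ + b * ‖w‖ := by
    refine (norm_add_le _ _).trans ?_
    rw [norm_smul, norm_smul, Real.norm_of_nonneg ha, Real.norm_of_nonneg hb.le]
  rw [inner_add_right, inner_smul_right, inner_smul_right]
  have h1 := mul_le_mul_of_nonneg_left hv ha
  have h2 := mul_lt_mul_of_pos_left hw hb
  have h3 := mul_le_mul_of_nonneg_left hv' ha
  have h4 := mul_lt_mul_of_pos_left hw' hb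
  have h5 := mul_le_mul_of_nonneg_left hn hc
  constructor
  · have : a * h + b * h = h := by rw [← add_mul, hab, one_mul]
    linarith
  · linarith

theorem convex_finiteCone (hc : 0 ≤ Real.cos (ρ / 2)) : Convex ℝ (finiteCone ρ h ξ y) := by
  rw [convex_iff_forall_pos]
  intro v hv w hw a b ha hb hab
  rw [mem_finiteCone_iff] at hv hw ⊢
  have : a • v + b • w - y = a • (v - y) + b • (w - y) := by
    rw [smul_sub, smul_sub, sub_add_sub_comm, ← add_smul, hab, one_smul]
  rw [this]
  exact segment_subset_finiteCone_aux hc ha.le hb hab hv.1.le hv.2.le hw.1 hw.2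

theorem axis_mem_finiteCone (hc : Real.cos (ρ / 2) < 1) (hh : 0 < h) (hξ : ‖ξ‖ = 1) :
    y + (h / 2) • ξ ∈ finiteCone ρ h ξ y := by
  rw [mem_finiteCone_iff, add_sub_cancel_left, norm_smul, hξ, inner_smul_right,
    real_inner_self_eq_norm_sq, hξ, Real.norm_of_nonneg (by positivity)]
  constructor
  · linarith
  · nlinarith

theorem closedCone_subset_closure (hc : 0 ≤ Real.cos (ρ / 2)) (hc' : Real.cos (ρ / 2) < 1)
    (hh : 0 < h) (hξ : ‖ξ‖ = 1) : closedCone ρ h ξ y ⊆ closure (finiteCone ρ h ξ y) := by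
  intro z hz
  set p := y + (h / 2) • ξ
  have hp := mem_finiteCone_iff.1 (axis_mem_finiteCone (y := y) hc' hh hξ)
  have hlim : Tendsto (fun t : ℝ => (1 - t) • z + t • p) (𝓝[>] 0) (𝓝 z) := by
    have : Tendsto (fun t : ℝ => (1 - t) • z + t • p) (𝓝 0) (𝓝 ((1 - (0 : ℝ)) • z + (0 : ℝ) • p)) :=
      Continuous.tendsto (by fun_prop) 0
    simpa using this.mono_left nhdsWithin_le_nhds
  refine mem_closure_of_tendsto hlim ?_
  filter_upwards [Ioo_mem_nhdsGT (zero_lt_one' ℝ)] with t ht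
  rw [mem_finiteCone_iff]
  have : (1 - t) • z + t • p - y = (1 - t) • (z - y) + t • (p - y) := by
    rw [smul_sub, smul_sub, sub_add_sub_comm, ← add_smul, sub_add_cancel, one_smul]
  rw [this]
  exact segment_subset_finiteCone_aux hc (by linarith [ht.2]) ht.1 (by ring) hz.1 hz.2 hp.1 hp.2

/-- Cones that miss longer and longer initial parts of a sequence and come arbitrarily close to `x`
accumulate at a cone that misses the whole sequence and has `x` in its closure. -/
theorem exists_cone_disjoint_range {u : ℕ → EuclideanSpace ℝ (Fin d)}
    (H : ∀ n : ℕ, ∃ ξ y q : EuclideanSpace ℝ (Fin d), ‖ξ‖ = 1 ∧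
      Disjoint (finiteCone ρ h ξ y) (sampleSet u n) ∧ q ∈ closedCone ρ h ξ y ∧
      dist q x < 1 / ((n : ℝ) + 1)) :
    ∃ ξ y : EuclideanSpace ℝ (Fin d), ‖ξ‖ = 1 ∧
      Disjoint (finiteCone ρ h ξ y) (range u) ∧ x ∈ closedCone ρ h ξ y := by
  choose ξ y q hξ hdisj hq hqx using H
  have hqlim : Tendsto q atTop (𝓝 x) := by
    rw [tendsto_iff_dist_tendsto_zero]
    exact squeeze_zero (fun _ => dist_nonneg) (fun n => (hqx n).le)
      tendsto_one_div_add_atTop_nhds_zero_nat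
  have hmem : ∀ n, (ξ n, y n) ∈ sphere (0 : EuclideanSpace ℝ (Fin d)) 1 ×ˢ closedBall x (h + 1) := by
    refine fun n => ⟨by simp [hξ n], ?_⟩
    have h1 : dist (y n) (q n) ≤ h := by rw [dist_comm, dist_eq_norm]; exact (hq n).1
    have h2 : 1 / ((n : ℝ) + 1) ≤ 1 := by
      rw [div_le_one (by positivity)]; linarith [Nat.cast_nonneg (α := ℝ) n]
    simp only [mem_closedBall]
    linarith [dist_triangle (y n) (q n) x, hqx n]
  obtain ⟨⟨ξ', y'⟩, hmem', φ, hφ, hlim⟩ :=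
    ((isCompact_sphere _ _).prod (isCompact_closedBall _ _)).tendsto_subseq hmem
  have hξlim : Tendsto (fun n => ξ (φ n)) atTop (𝓝 ξ') := (continuous_fst.tendsto _).comp hlim
  have hylim : Tendsto (fun n => y (φ n)) atTop (𝓝 y') := (continuous_snd.tendsto _).comp hlim
  have hqlim' : Tendsto (fun n => q (φ n)) atTop (𝓝 x) := hqlim.comp hφ.tendsto_atTop
  refine ⟨ξ', y', by simpa using hmem'.1, ?_, ?_, ?_⟩
  · rw [Set.disjoint_left]
    rintro _ hz ⟨i, rfl⟩
    rw [mem_finiteCone_iff] at hz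
    -- Strict inequalities at the limit cone persist for nearby cones, so `u i` would lie in a late
    -- cone although `φ n > i` puts it in the sample which that cone misses.
    have hsub : Tendsto (fun n => u i - y (φ n)) atTop (𝓝 (u i - y')) :=
      tendsto_const_nhds.sub hylim
    have e1 := hsub.norm.eventually_lt_const hz.1
    have e2 := (hsub.norm.const_mul (Real.cos (ρ / 2))).eventually_lt (hξlim.inner hsub) hz.2
    obtain ⟨n, h1, h2, h3⟩ := (e1.and (e2.and (hφ.tendsto_atTop.eventually_gt_atTop i))).exists
    exact Set.disjoint_left.1 (hdisj (φ n)) (mem_finiteCone_iff.2 ⟨h1, h2⟩) (mem_image_of_mem u h3)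
  · exact le_of_tendsto (hqlim'.sub hylim).norm (Eventually.of_forall fun n => (hq (φ n)).1)
  · exact le_of_tendsto_of_tendsto ((hqlim'.sub hylim).norm.const_mul _)
      (hξlim.inner (hqlim'.sub hylim)) (Eventually.of_forall fun n => (hq (φ n)).2)

end Cones

/-! ### Lebesgue density and convex sets -/

section Density

variable {E : Type*} [NormedAddCommGroup E] [NormedSpace ℝ E] [FiniteDimensional ℝ E]
  [MeasurableSpace E] [BorelSpace E] (μ : Measure E) [μ.IsAddHaarMeasure]

/-- A point in the closure of an open convex set disjoint from `S` is not a density point of `S`. -/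
theorem not_tendsto_density_of_mem_closure_convex {S K : Set E} {x : E}
    (hK : Convex ℝ K) (hKo : IsOpen K) (hKne : K.Nonempty) (hKS : Disjoint K S)
    (hx : x ∈ closure K) :
    ¬ Tendsto (fun r => μ (S ∩ closedBall x r) / μ (closedBall x r)) (𝓝[>] 0) (𝓝 1) := by
  intro hlim
  obtain ⟨p, hp⟩ := hKne
  obtain ⟨r, hr, hrK⟩ := Metric.isOpen_iff.1 hKo p hp
  -- `closedBall x R` contains `ball p r`. Shrinking both towards `x` by `t` keeps the volume ratio
  -- `c`, and convexity keeps the small ball in `K`, so `S` misses a fixed proportion of each ball.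
  set R := ‖p - x‖ + r
  have hR : 0 < R := by positivity
  have hRlim : Tendsto (fun t : ℝ => t * R) (𝓝[>] 0) (𝓝[>] 0) := by
    refine tendsto_nhdsWithin_iff.2 ⟨?_, ?_⟩
    · have : Tendsto (fun t : ℝ => t * R) (𝓝 0) (𝓝 (0 * R)) := Continuous.tendsto (by fun_prop) 0
      simpa using this.mono_left nhdsWithin_le_nhds
    · filter_upwards [self_mem_nhdsWithin] with t ht using mul_pos ht hR
  set c := μ (ball 0 r) / μ (closedBall 0 R)
  have hc : c ≠ 0 :=
    (ENNReal.div_pos (measure_ball_pos μ 0 hr).ne' measure_closedBall_lt_top.ne).ne'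
  have key : ∀ t ∈ Ioo (0 : ℝ) 1,
      μ (S ∩ closedBall x (t * R)) / μ (closedBall x (t * R)) + c ≤ 1 := by
    rintro t ⟨ht0, ht1⟩
    set b := x + t • (p - x)
    have hbK : ball b (t * r) ⊆ K := by
      intro q hq
      -- This is the preimage of `q` under the homothety of centre `x` and ratio `t`.
      have hq' : p + t⁻¹ • (q - b) ∈ K := by
        refine hrK ?_
        rw [mem_ball_iff_norm, add_sub_cancel_left, norm_smul, norm_inv, Real.norm_of_nonneg ht0.le,
          inv_mul_lt_iff₀ ht0]
        exact mem_ball_iff_norm.1 hq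
      have := hK.combo_closure_interior_mem_interior hx (hKo.interior_eq.symm ▸ hq')
        (sub_nonneg.2 ht1.le) ht0 (sub_add_cancel 1 t)
      rw [hKo.interior_eq] at this
      convert this using 1
      rw [smul_add, smul_smul, mul_inv_cancel₀ ht0.ne']
      module
    have hbB : ball b (t * r) ⊆ closedBall x (t * R) := by
      refine ball_subset_closedBall.trans (closedBall_subset_closedBall' ?_)
      rw [dist_eq_norm, add_sub_cancel_left, norm_smul, Real.norm_of_nonneg ht0.le]
      simp only [R]
      linarith
    have hsum : μ (S ∩ closedBall x (t * R)) + μ (ball b (t * r)) ≤ μ (closedBall x (t * R)) := by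
      rw [← measure_union _ measurableSet_ball]
      · exact measure_mono (union_subset inter_subset_right hbB)
      · exact (hKS.symm.mono_right hbK).mono_left inter_subset_left
    have hpos : μ (closedBall x (t * R)) ≠ 0 :=
      (measure_closedBall_pos μ x (mul_pos ht0 hR)).ne'
    have hcEq : c = μ (ball b (t * r)) / μ (closedBall x (t * R)) := by
      rw [Measure.addHaar_ball_mul_of_pos μ b ht0, Measure.addHaar_closedBall_mul μ x ht0.le hR.le,
        ENNReal.mul_div_mul_left _ _ (by positivity) ENNReal.ofReal_ne_top]
    rw [hcEq, ← ENNReal.add_div]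
    exact ENNReal.div_le_of_le_mul (by simpa using hsum)
  have hle : (1 : ENNReal) + c ≤ 1 := by
    refine le_of_tendsto ((hlim.comp hRlim).add_const c) ?_
    filter_upwards [Ioo_mem_nhdsGT (zero_lt_one' ℝ)] with t ht using key t ht
  exact hc (nonpos_iff_eq_zero.1
    ((ENNReal.add_le_add_iff_left ENNReal.one_ne_top).1 (hle.trans (add_zero 1).ge)))

theorem measure_eq_zero_of_mem_closure_convex {S N : Set E} (hNS : N ⊆ S) (hS : MeasurableSet S)
    (hN : ∀ x ∈ N, ∃ K : Set E, Convex ℝ K ∧ IsOpen K ∧ K.Nonempty ∧ Disjoint K S ∧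
      x ∈ closure K) : μ N = 0 := by
  have hae := (ae_restrict_iff' hS).1 (Besicovitch.ae_tendsto_measure_inter_div μ S)
  refine measure_mono_null (fun x hx => ?_) (ae_iff.1 hae)
  obtain ⟨K, hK, hKo, hKne, hKS, hxK⟩ := hN x hx
  exact fun hlim =>
    not_tendsto_density_of_mem_closure_convex μ hK hKo hKne hKS hxK (hlim (hNS hx))

end Density

/-! ### The two hulls and the points they leave out -/

section Hulls

variable {d : ℕ} {ρ h : ℝ}

theorem subset_ccHull (A : Set (EuclideanSpace ℝ (Fin d))) : A ⊆ ccHull ρ h A :=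
  subset_sInter fun _ hB => hB.2

theorem ccHull_mono {A B : Set (EuclideanSpace ℝ (Fin d))} (hAB : A ⊆ B) :
    ccHull ρ h A ⊆ ccHull ρ h B :=
  sInter_subset_sInter fun _ hC => ⟨hC.1, hAB.trans hC.2⟩

theorem isClosed_ccHull (A : Set (EuclideanSpace ℝ (Fin d))) : IsClosed (ccHull ρ h A) :=
  isClosed_sInter fun _ hB => hB.1.2.1.isClosed

theorem subset_cccHull (A : Set (EuclideanSpace ℝ (Fin d))) : A ⊆ cccHull ρ h A := by
  refine subset_sInter ?_
  rintro _ ⟨ξ, y, -, hd, rfl⟩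
  exact (Set.disjoint_iff_inter_eq_empty.2 hd).subset_compl_left

theorem cccHull_mono {A B : Set (EuclideanSpace ℝ (Fin d))} (hAB : A ⊆ B) :
    cccHull ρ h A ⊆ cccHull ρ h B := by
  refine sInter_subset_sInter ?_
  rintro _ ⟨ξ, y, hξ, hd, rfl⟩
  exact ⟨ξ, y, hξ, subset_eq_empty (inter_subset_inter_right _ hAB) hd, rfl⟩

theorem isClosed_cccHull (A : Set (EuclideanSpace ℝ (Fin d))) : IsClosed (cccHull ρ h A) := by
  refine isClosed_sInter ?_
  rintro _ ⟨ξ, y, -, -, rfl⟩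
  exact isOpen_finiteCone.isClosed_compl

theorem sampleSet_mono (u : ℕ → EuclideanSpace ℝ (Fin d)) : Monotone (sampleSet u) :=
  fun _ _ hmn => image_mono (Iio_subset_Iio hmn)

/-- Some admissible `B ⊇ A` omits `x`. A point of `B` nearest to `x` lies on its frontier, hence is
a cone vertex, and is no farther from `x` than `p ∈ B`. -/
theorem exists_cone_of_notMem_ccHull (hh : 0 < h) {A : Set (EuclideanSpace ℝ (Fin d))}
    {x p : EuclideanSpace ℝ (Fin d)} (hp : p ∈ A) (hx : x ∉ ccHull ρ h A) :
    ∃ ξ y q : EuclideanSpace ℝ (Fin d), ‖ξ‖ = 1 ∧ Disjoint (finiteCone ρ h ξ y) A ∧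
      q ∈ closedCone ρ h ξ y ∧ dist q x ≤ dist p x := by
  simp only [ccHull, mem_sInter, not_forall] at hx
  obtain ⟨B, ⟨⟨-, -, hB⟩, hAB⟩, hxB⟩ := hx
  obtain ⟨y, hy, hxy⟩ := exists_mem_frontier_infDist_compl_eq_dist (s := Bᶜ) (x := x) hxB
    (fun huniv => (huniv.symm ▸ mem_univ p : p ∈ Bᶜ) (hAB hp))
  rw [frontier_compl] at hy
  rw [compl_compl] at hxy
  obtain ⟨ξ, hξ, hcone⟩ := hB y hy
  refine ⟨ξ, y, y, hξ, (Set.subset_compl_iff_disjoint_right.1 hcone).mono_right hAB,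
    vertex_mem_closedCone hh, ?_⟩
  rw [dist_comm y, dist_comm p, ← hxy]
  exact infDist_le_dist_of_mem (hAB hp)

/-- Here the excluding cone contains `x` itself, so `q = x` works; the form matches the other hull.
-/
theorem exists_cone_of_notMem_cccHull {A : Set (EuclideanSpace ℝ (Fin d))}
    {x p : EuclideanSpace ℝ (Fin d)} (hx : x ∉ cccHull ρ h A) :
    ∃ ξ y q : EuclideanSpace ℝ (Fin d), ‖ξ‖ = 1 ∧ Disjoint (finiteCone ρ h ξ y) A ∧
      q ∈ closedCone ρ h ξ y ∧ dist q x ≤ dist p x := by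
  simp only [cccHull, mem_sInter, not_forall] at hx
  obtain ⟨_, ⟨ξ, y, hξ, hd, rfl⟩, hxc⟩ := hx
  exact ⟨ξ, y, x, hξ, Set.disjoint_iff_inter_eq_empty.2 hd,
    finiteCone_subset_closedCone (not_notMem.1 hxc), by simp⟩

/-- If points outside a hull operator see a cone disjoint from the set whose closure is at least as
close as any given point of the set, then the hulls of a dense sample exhaust almost all of `S`. -/
theorem volume_diff_iUnion_hull_eq_zero (hρ : 0 < ρ) (hρπ : ρ ≤ Real.pi) (hh : 0 < h)
    {S : Set (EuclideanSpace ℝ (Fin d))} (hS : IsClosed S) {u : ℕ → EuclideanSpace ℝ (Fin d)}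
    (hdense : S ⊆ closure (range u))
    {H : Set (EuclideanSpace ℝ (Fin d)) → Set (EuclideanSpace ℝ (Fin d))}
    (hH : ∀ (A : Set (EuclideanSpace ℝ (Fin d))) (x p : EuclideanSpace ℝ (Fin d)),
      p ∈ A → x ∉ H A → ∃ ξ y q : EuclideanSpace ℝ (Fin d), ‖ξ‖ = 1 ∧
        Disjoint (finiteCone ρ h ξ y) A ∧ q ∈ closedCone ρ h ξ y ∧ dist q x ≤ dist p x) :
    volume (S \ ⋃ n, H (sampleSet u n)) = 0 := by
  have hc : 0 ≤ Real.cos (ρ / 2) := Real.cos_nonneg_of_mem_Icc ⟨by linarith, by linarith⟩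
  have hc' : Real.cos (ρ / 2) < 1 := by
    have := Real.cos_lt_cos_of_nonneg_of_le_pi le_rfl (by linarith) (half_pos hρ)
    rwa [Real.cos_zero] at this
  refine measure_eq_zero_of_mem_closure_convex volume sdiff_subset hS.measurableSet ?_
  rintro x ⟨hxS, hxH⟩
  simp only [mem_iUnion, not_exists] at hxH
  obtain ⟨ξ, y, hξ, hdisj, hx⟩ := exists_cone_disjoint_range (ρ := ρ) (h := h) (x := x) (u := u)
    (fun n => by
      obtain ⟨_, ⟨i, rfl⟩, hi⟩ := Metric.mem_closure_iff.1 (hdense hxS) (1 / ((n : ℝ) + 1))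
        (by positivity)
      -- The sample is enlarged to include `u i`, a point close to `x`.
      obtain ⟨ξ, y, q, hξ, hd, hq, hqx⟩ := hH (sampleSet u (max n (i + 1))) x (u i)
        (mem_image_of_mem u (by simp)) (hxH _)
      exact ⟨ξ, y, q, hξ, hd.mono_right (sampleSet_mono u (le_max_left _ _)), hq,
        hqx.trans_lt (by rwa [dist_comm])⟩)
  exact ⟨finiteCone ρ h ξ y, convex_finiteCone hc, isOpen_finiteCone,
    ⟨_, axis_mem_finiteCone hc' hh hξ⟩,
    (hdisj.closure_right isOpen_finiteCone).mono_right hdense,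
    closedCone_subset_closure hc hc' hh hξ hx⟩

end Hulls

/-! ### From exhaustion to convergence -/

section Convergence

variable {d : ℕ} {S : Set (EuclideanSpace ℝ (Fin d))} {u : ℕ → EuclideanSpace ℝ (Fin d)}
  {H : ℕ → Set (EuclideanSpace ℝ (Fin d))}

/-- The `ε`-balls around the sample points cover `S`, so by compactness finitely many observations
suffice. -/
theorem tendsto_hausdorffEDist_of_sampleSet_subset (hS : IsCompact S)
    (hdense : S ⊆ closure (range u)) (hsample : ∀ n, sampleSet u n ⊆ H n) (hHS : ∀ n, H n ⊆ S) :
    Tendsto (fun n => hausdorffEDist (H n) S) atTop (𝓝 0) := by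
  rw [ENNReal.tendsto_atTop_zero]
  intro ε hε
  obtain ⟨N, hN⟩ := hS.elim_directed_cover (fun n : ℕ => ⋃ z ∈ sampleSet u n, eball z ε)
    (fun n => isOpen_biUnion fun _ _ => isOpen_eball)
    (fun x hx => by
      obtain ⟨_, ⟨i, rfl⟩, hi⟩ := EMetric.mem_closure_iff.1 (hdense hx) ε hε
      exact mem_iUnion.2 ⟨i + 1, mem_biUnion (mem_image_of_mem u (by simp)) hi⟩)
    (Monotone.directed_le fun m n hmn => biUnion_subset_biUnion_left (sampleSet_mono u hmn))
  refine ⟨N, fun n hn => hausdorffEDist_le_of_mem_edist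
    (fun x hx => ⟨x, hHS n hx, by simp⟩) fun x hx => ?_⟩
  obtain ⟨z, hz, hxz⟩ := mem_iUnion₂.1 (hN hx)
  exact ⟨z, hsample n (sampleSet_mono u hn hz), (mem_eball.1 hxz).le⟩

theorem tendsto_distMeasure_of_monotone {ν : Measure (EuclideanSpace ℝ (Fin d))}
    [IsFiniteMeasureOnCompacts ν] (hS : IsCompact S) (hHS : ∀ n, H n ⊆ S) (hH : Monotone H)
    (hHc : ∀ n, IsClosed (H n)) (hnull : ν (S \ ⋃ n, H n) = 0) :
    Tendsto (fun n => distMeasure ν (H n) S) atTop (𝓝 0) := by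
  have h1 : ∀ n, distMeasure ν (H n) S = ν (S \ H n) := fun n => by
    simp [distMeasure, sdiff_eq_empty.2 (hHS n)]
  simp only [h1]
  rw [sdiff_iUnion] at hnull
  rw [← hnull]
  exact tendsto_measure_iInter_atTop
    (fun n => (hS.isClosed.measurableSet.diff (hHc n).measurableSet).nullMeasurableSet)
    (fun m n hmn => sdiff_subset_sdiff_right (hH hmn))
    ⟨0, ((measure_mono sdiff_subset).trans_lt hS.measure_lt_top).ne⟩

end Convergence

/-! ### Almost sure density of the sample in the support -/

section Sampling

variable {Ω E : Type*} [MeasurableSpace Ω] {Pr : Measure Ω} [MeasurableSpace E]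
  {P : Measure E} {X : ℕ → Ω → E}

/-- By independence, the first `n` observations all miss `U` with probability `P Uᶜ ^ n`, which
tends to zero. -/
theorem ae_exists_mem_of_measure_pos [IsProbabilityMeasure P]
    (hXmeas : ∀ i, Measurable (X i)) (hXindep : iIndepFun X Pr)
    (hXlaw : ∀ i, Measure.map (X i) Pr = P) {U : Set E} (hU : MeasurableSet U) (hPU : 0 < P U) :
    ∀ᵐ ω ∂Pr, ∃ i, X i ω ∈ U := by
  have hlt : P Uᶜ < 1 := by
    rw [prob_compl_eq_one_sub hU]
    exact ENNReal.sub_lt_self ENNReal.one_ne_top one_ne_zero hPU.ne'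
  have hle : ∀ n : ℕ, Pr {ω | ¬ ∃ i, X i ω ∈ U} ≤ P Uᶜ ^ n := fun n => by
    calc Pr {ω | ¬ ∃ i, X i ω ∈ U} ≤ Pr (⋂ i ∈ Finset.range n, X i ⁻¹' Uᶜ) :=
          measure_mono fun ω hω => mem_iInter₂.2 fun i _ hi => hω ⟨i, hi⟩
      _ = ∏ i ∈ Finset.range n, Pr (X i ⁻¹' Uᶜ) :=
          hXindep.measure_inter_preimage_eq_mul _ fun _ _ => hU.compl
      _ = P Uᶜ ^ n := by
          simp_rw [← Measure.map_apply (hXmeas _) hU.compl, hXlaw]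
          simp
  exact ae_iff.2 (le_antisymm
    (ge_of_tendsto' (ENNReal.tendsto_pow_atTop_nhds_zero_of_lt_one hlt) hle) zero_le)

theorem ae_support_subset_closure_range [TopologicalSpace E] [BorelSpace E]
    [SecondCountableTopology E] [IsProbabilityMeasure P]
    (hXmeas : ∀ i, Measurable (X i)) (hXindep : iIndepFun X Pr)
    (hXlaw : ∀ i, Measure.map (X i) Pr = P) :
    ∀ᵐ ω ∂Pr, P.support ⊆ closure (range fun i => X i ω) := by
  have hb := TopologicalSpace.isBasis_countableBasis E
  have : ∀ᵐ ω ∂Pr, ∀ U ∈ TopologicalSpace.countableBasis E, 0 < P U → ∃ i, X i ω ∈ U := by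
    refine (ae_ball_iff (TopologicalSpace.countable_countableBasis E)).2 fun U hU => ?_
    by_cases hPU : 0 < P U
    · filter_upwards [ae_exists_mem_of_measure_pos hXmeas hXindep hXlaw (hb.isOpen hU).measurableSet
        hPU] with ω hω _ using hω
    · simp [hPU]
  filter_upwards [this] with ω hω x hx
  refine hb.mem_closure_iff.2 fun U hU hxU => ?_
  obtain ⟨i, hi⟩ := hω U hU
    ((Measure.mem_support_iff_forall x).1 hx U ((hb.isOpen hU).mem_nhds hxU))
  exact ⟨X i ω, hi, i, rfl⟩

theorem ae_forall_mem_support [TopologicalSpace E] [HereditarilyLindelofSpace E]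
    (hXmeas : ∀ i, Measurable (X i))
    (hXlaw : ∀ i, Measure.map (X i) Pr = P) : ∀ᵐ ω ∂Pr, ∀ i, X i ω ∈ P.support := by
  refine ae_all_iff.2 fun i => ?_
  have : ∀ᵐ z ∂(Measure.map (X i) Pr), z ∈ P.support := by
    rw [hXlaw]
    exact Measure.support_mem_ae
  exact ae_of_ae_map (hXmeas i).aemeasurable this

end Sampling

/-- Consistency of a monotone, closed-valued hull operator `H` for which the hull of a sample
contained in the support stays in the support, and points outside a hull see a disjoint cone. -/
theorem hull_consistency {Ω : Type*} [MeasurableSpace Ω] {Pr : Measure Ω} {d : ℕ}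
    {P : Measure (EuclideanSpace ℝ (Fin d))} [IsProbabilityMeasure P]
    (hP : P ≪ (volume : Measure (EuclideanSpace ℝ (Fin d)))) (hS : IsCompact P.support)
    {X : ℕ → Ω → EuclideanSpace ℝ (Fin d)} (hXmeas : ∀ i, Measurable (X i))
    (hXindep : iIndepFun X Pr) (hXlaw : ∀ i, Measure.map (X i) Pr = P)
    {ρ h : ℝ} (hρ : 0 < ρ) (hρπ : ρ ≤ Real.pi) (hh : 0 < h)
    {H : Set (EuclideanSpace ℝ (Fin d)) → Set (EuclideanSpace ℝ (Fin d))}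
    (hHsub : ∀ A, A ⊆ H A) (hHmono : ∀ A B, A ⊆ B → H A ⊆ H B) (hHcl : ∀ A, IsClosed (H A))
    (hHcone : ∀ (A : Set (EuclideanSpace ℝ (Fin d))) (x p : EuclideanSpace ℝ (Fin d)),
      p ∈ A → x ∉ H A → ∃ ξ y q : EuclideanSpace ℝ (Fin d), ‖ξ‖ = 1 ∧
        Disjoint (finiteCone ρ h ξ y) A ∧ q ∈ closedCone ρ h ξ y ∧ dist q x ≤ dist p x)
    (hHS : H P.support ⊆ P.support) :
    (∀ᵐ ω ∂Pr, Tendsto (fun n : ℕ => hausdorffEDist (H (sampleSet (fun i => X i ω) n)) P.support)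
      atTop (𝓝 0)) ∧
    (∀ (ν : Measure (EuclideanSpace ℝ (Fin d))) [IsFiniteMeasureOnCompacts ν],
      ν.restrict P.support ≪ P →
      ∀ᵐ ω ∂Pr, Tendsto (fun n : ℕ => distMeasure ν (H (sampleSet (fun i => X i ω) n)) P.support)
        atTop (𝓝 0)) := by
  have hae := (ae_support_subset_closure_range hXmeas hXindep hXlaw).and
    (ae_forall_mem_support hXmeas hXlaw)
  have hsub : ∀ ω, (∀ i, X i ω ∈ P.support) →
      ∀ n, H (sampleSet (fun i => X i ω) n) ⊆ P.support := fun ω hω n =>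
    (hHmono _ _ (by rintro _ ⟨i, -, rfl⟩; exact hω i)).trans hHS
  constructor
  · filter_upwards [hae] with ω hω
    exact tendsto_hausdorffEDist_of_sampleSet_subset hS hω.1 (fun n => hHsub _) (hsub ω hω.2)
  · intro ν _ hν
    filter_upwards [hae] with ω hω
    refine tendsto_distMeasure_of_monotone hS (hsub ω hω.2)
      (fun m n hmn => hHmono _ _ (sampleSet_mono _ hmn)) (fun n => hHcl _) ?_
    -- Nullity passes from Lebesgue measure to `P`, then to `ν` restricted to the support.
    have h0 := hν (hP (volume_diff_iUnion_hull_eq_zero hρ hρπ hh hS.isClosed hω.1 hHcone))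
    rwa [Measure.restrict_apply' hS.isClosed.measurableSet, inter_eq_left.2 sdiff_subset] at h0

end ConeConvexity

theorem theorem4 {Ω : Type*} [MeasurableSpace Ω] (Pr : Measure Ω) [IsProbabilityMeasure Pr]
    (d : ℕ) (P : Measure (EuclideanSpace ℝ (Fin d))) [IsProbabilityMeasure P]
    (hP : P ≪ (volume : Measure (EuclideanSpace ℝ (Fin d))))
    (hS : IsCompact P.support)
    (X : ℕ → Ω → EuclideanSpace ℝ (Fin d))
    (hXmeas : ∀ i, Measurable (X i))
    (hXindep : iIndepFun X Pr)
    (hXlaw : ∀ i, Measure.map (X i) Pr = P)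
    (ρ h : ℝ) (hρ : 0 < ρ) (hρπ : ρ ≤ Real.pi) (hh : 0 < h) :
    (ConeConvexity.IsConeConvex ρ h P.support →
      (∀ᵐ ω ∂Pr, Tendsto (fun n : ℕ => Metric.hausdorffEDist
          (ConeConvexity.ccHull ρ h (ConeConvexity.sampleSet (fun i => X i ω) n)) P.support)
          atTop (𝓝 0)) ∧
      (∀ (ν : Measure (EuclideanSpace ℝ (Fin d))) [IsFiniteMeasureOnCompacts ν],
        ν.restrict P.support ≪ P →
        ∀ᵐ ω ∂Pr, Tendsto (fun n : ℕ => ConeConvexity.distMeasure ν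
          (ConeConvexity.ccHull ρ h (ConeConvexity.sampleSet (fun i => X i ω) n)) P.support)
          atTop (𝓝 0))) ∧
    (P.support ∈ ConeConvexity.coneConvexByComplClass d ρ h →
      (∀ᵐ ω ∂Pr, Tendsto (fun n : ℕ => Metric.hausdorffEDist
          (ConeConvexity.cccHull ρ h (ConeConvexity.sampleSet (fun i => X i ω) n)) P.support)
          atTop (𝓝 0)) ∧
      (∀ (ν : Measure (EuclideanSpace ℝ (Fin d))) [IsFiniteMeasureOnCompacts ν],
        ν.restrict P.support ≪ P →
        ∀ᵐ ω ∂Pr, Tendsto (fun n : ℕ => ConeConvexity.distMeasure ν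
          (ConeConvexity.cccHull ρ h (ConeConvexity.sampleSet (fun i => X i ω) n)) P.support)
          atTop (𝓝 0))) := by
  exact
    ⟨fun hcc => ConeConvexity.hull_consistency hP hS hXmeas hXindep hXlaw hρ hρπ hh
      (H := ConeConvexity.ccHull ρ h) ConeConvexity.subset_ccHull
      (fun _ _ => ConeConvexity.ccHull_mono) ConeConvexity.isClosed_ccHull
      (fun _ _ _ => ConeConvexity.exists_cone_of_notMem_ccHull hh)
      (Set.sInter_subset_of_mem
        ⟨⟨Measure.nonempty_support (IsProbabilityMeasure.ne_zero P), hS, hcc⟩, subset_rfl⟩),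
    fun hccc => ConeConvexity.hull_consistency hP hS hXmeas hXindep hXlaw hρ hρπ hh
      (H := ConeConvexity.cccHull ρ h) ConeConvexity.subset_cccHull
      (fun _ _ => ConeConvexity.cccHull_mono) ConeConvexity.isClosed_cccHull
      (fun _ _ _ _ => ConeConvexity.exists_cone_of_notMem_cccHull)
      hccc.2.2.ge⟩
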